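/- **Setting.** Let $X=(X_1,\dots,X_p)$ be a vector of independent random inputs, $X_i$ taking values in a measurable space $\mathcal X_i$, let $f:\mathcal X_1\times\dots\times\mathcal X_p\to\mathbb R$ be measurable, and let $Y=f(X)$ with $\mathrm{Var}(Y)\neq 0$. Let $u_1,\dots,u_k$ be subsets of $\{1,\dots,p\}$ and $\mathbf u=(u_1,\dots,u_k)$. For each $j$ let $X'^{(j)}$ be an independent copy of $X$ (independent of $X$, with the same law); the joint dependence of $X,X'^{(1)},\dots,X'^{(k)}$ is otherwise arbitrary (for instance they may all be the same copy, or be mutually independent). Put $Y^{u_j}=f(X^{u_j})$, where $X^{u_j}_i=X_i$ for $i\in u_j$ and $X^{u_j}_i=X'^{(j)}_i$ for $i\notin u_j$. The vector of closed Sobol indices is $$S_{\mathrm{Cl}}^{\mathbf u}=\bigl(S_{\mathrm{Cl}}^{u_1},\dots,S_{\mathrm{Cl}}^{u_k}\bigr),\qquad S_{\mathrm{Cl}}^{u_j}=\frac{\mathrm{Var}\bigl(\mathbb E(Y\mid X_i,\ i\in u_j)\bigr)}{\mathrm{Var}(Y)} .$$ Let $(Y_i,Y_i^{u_1},\dots,Y_i^{u_k})_{i\ge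 1}$ be i.i.d. copies of $(Y,Y^{u_1},\dots,Y^{u_k})$, and put $$Z_i^{\mathbf u}=\frac1{k+1}\Bigl(Y_i+\sum_{j=1}^kY_i^{u_j}\Bigr),\qquad M_i^{\mathbf u}=\frac1{k+1}\Bigl(Y_i^2+\sum_{j=1}^k(Y_i^{u_j})^2\Bigr).$$ With all sums over $i=1,\dots,N$, the two pick-freeze estimators $S_{N,\mathrm{Cl}}^{\mathbf u},T_{N,\mathrm{Cl}}^{\mathbf u}\in\mathbb R^k$ have the components $$\bigl(S_{N,\mathrm{Cl}}^{\mathbf u}\bigr)_j=\frac{\frac1N\sum Y_iY_i^{u_j}-\bigl(\frac1N\sum Y_i\bigr)\bigl(\frac1N\sum Y_i^{u_j}\bigr)}{\frac1N\sum Y_i^2-\bigl(\frac1N\sum Y_i\bigr)^2},\qquad \bigl(T_{N,\mathrm{Cl}}^{\mathbf u}\bigr)_j=\frac{\frac1N\sum Y_iY_i^{u_j}-\bigl(\frac1{2N}\sum (Y_i+Y_i^{u_j})\bigr)^2}{\frac1N\sum M_i^{\mathbf u}-\bigl(\frac1N\sum Z_i^{\mathbf u}\bigr)^2}$$ (with value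 $0$ when the denominator vanishes). Finally let $\bar Y=Y-\mathbb E(Y)$, $\bar Y^{u_j}=Y^{u_j}-\mathbb E(Y^{u_j})$ be the centered outputs and $\bar M^{\mathbf u}=\frac1{k+1}\bigl(\bar Y^2+\sum_{j=1}^k(\bar Y^{u_j})^2\bigr)$. **Theorem 3.1.** Assume that $\mathbb E(Y^4)<\infty$. Then: 1. $\displaystyle \sqrt N\bigl(S_{N,\mathrm{Cl}}^{\mathbf u}-S_{\mathrm{Cl}}^{\mathbf u}\bigr)\xrightarrow[N\to\infty]{\mathcal L}\mathcal N_k(0,\Gamma_{\mathbf u,S})$, where $\Gamma_{\mathbf u,S}$ is the positive semidefinite matrix with entries, for $1\le l,j\le k$, $$(\Gamma_{\mathbf u,S})_{l,j}=\frac{\mathrm{Cov}(\bar Y\bar Y^{u_l},\bar Y\bar Y^{u_j})-S_{\mathrm{Cl}}^{u_l}\mathrm{Cov}(\bar Y\bar Y^{u_j},\bar Y^2)-S_{\mathrm{Cl}}^{u_j}\mathrm{Cov}(\bar Y\bar Y^{u_l},\bar Y^2)+S_{\mathrm{Cl}}^{u_j}S_{\mathrm{Cl}}^{u_l}\mathrm{Var}(\bar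 Y^2)}{(\mathrm{Var}\,Y)^2}.$$ 2. $\displaystyle \sqrt N\bigl(T_{N,\mathrm{Cl}}^{\mathbf u}-S_{\mathrm{Cl}}^{\mathbf u}\bigr)\xrightarrow[N\to\infty]{\mathcal L}\mathcal N_k(0,\Gamma_{\mathbf u,T})$, where $\Gamma_{\mathbf u,T}$ is the positive semidefinite matrix with entries, for $1\le l,j\le k$, $$(\Gamma_{\mathbf u,T})_{l,j}=\frac{\mathrm{Cov}(\bar Y\bar Y^{u_l},\bar Y\bar Y^{u_j})-S_{\mathrm{Cl}}^{u_l}\mathrm{Cov}(\bar Y\bar Y^{u_j},\bar M^{\mathbf u})-S_{\mathrm{Cl}}^{u_j}\mathrm{Cov}(\bar Y\bar Y^{u_l},\bar M^{\mathbf u})+S_{\mathrm{Cl}}^{u_j}S_{\mathrm{Cl}}^{u_l}\mathrm{Var}(\bar M^{\mathbf u})}{(\mathrm{Var}\,Y)^2}.$$ -/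

import Mathlib

open MeasureTheory ProbabilityTheory Filter

noncomputable section

namespace PickFreeze

/-- The pick-freeze input `x^v`: the coordinates in `v` are frozen (taken from `x`), the others are
taken from `x'`. -/
def mix {p : ℕ} {E : Fin p → Type*} (v : Finset (Fin p)) (x x' : ∀ i, E i) : ∀ i, E i :=
  fun i => if i ∈ v then x i else x' i

/-- The output `Y = f(X)`. -/
def output {p : ℕ} {E : Fin p → Type*} {Ω : Type*} (f : (∀ i, E i) → ℝ) (X : ∀ i, Ω → E i) :
    Ω → ℝ :=
  fun ω => f (fun i => X i ω)

/-- The pick-freeze output `Y^v = f(X^v)`, with `X'` the copy of `X` that provides the coordinates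
outside `v`. -/
def frozenOutput {p : ℕ} {E : Fin p → Type*} {Ω : Type*} (f : (∀ i, E i) → ℝ)
    (v : Finset (Fin p)) (X X' : ∀ i, Ω → E i) : Ω → ℝ :=
  fun ω => f (mix v (fun i => X i ω) (fun i => X' i ω))

/-- `X'` is an independent copy of the random vector `X`: it is independent of `X` and has the same
law. -/
def IsIndepCopy {p : ℕ} {E : Fin p → Type*} [∀ i, MeasurableSpace (E i)] {Ω : Type*}
    [MeasurableSpace Ω] (P : Measure Ω) (X X' : ∀ i, Ω → E i) : Prop :=
  IndepFun (fun ω i => X i ω) (fun ω i => X' i ω) P ∧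
    IdentDistrib (fun ω i => X' i ω) (fun ω i => X i ω) P P

/-- The σ-algebra generated by the inputs `X i`, `i ∈ v`. -/
abbrev sigmaOf {p : ℕ} {E : Fin p → Type*} [∀ i, MeasurableSpace (E i)] {Ω : Type*}
    (X : ∀ i, Ω → E i) (v : Finset (Fin p)) : MeasurableSpace Ω :=
  MeasurableSpace.comap (fun (ω : Ω) (i : v) => X i ω) inferInstance

/-- The closed Sobol index `Var(E(Y | X i, i ∈ v)) / Var(Y)`. -/
def closedIndex {p : ℕ} {E : Fin p → Type*} [∀ i, MeasurableSpace (E i)] {Ω : Type*}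
    [MeasurableSpace Ω] (P : Measure Ω) (X : ∀ i, Ω → E i) (Y : Ω → ℝ) (v : Finset (Fin p)) : ℝ :=
  Var[P[Y | sigmaOf X v]; P] / Var[Y; P]

/-- The vector of closed Sobol indices. -/
def closedIndices {p k : ℕ} {E : Fin p → Type*} [∀ i, MeasurableSpace (E i)] {Ω : Type*}
    [MeasurableSpace Ω] (P : Measure Ω) (X : ∀ i, Ω → E i) (Y : Ω → ℝ)
    (u : Fin k → Finset (Fin p)) : EuclideanSpace ℝ (Fin k) :=
  WithLp.toLp 2 fun j => closedIndex P X Y (u j)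

/-- The mean of the first `N` terms of a sequence. -/
def empMean (N : ℕ) (a : ℕ → ℝ) : ℝ := (∑ i ∈ Finset.range N, a i) / N

/-- `Z = (y + ∑ j, y^{u_j}) / (k + 1)`, for one observation `d = (y, (y^{u_j})_j)`. -/
def obsZ {k : ℕ} (d : ℝ × (Fin k → ℝ)) : ℝ := (d.1 + ∑ j, d.2 j) / (k + 1)

/-- `M = (y ^ 2 + ∑ j, (y^{u_j}) ^ 2) / (k + 1)`, for one observation `d = (y, (y^{u_j})_j)`. -/
def obsM {k : ℕ} (d : ℝ × (Fin k → ℝ)) : ℝ := (d.1 ^ 2 + ∑ j, d.2 j ^ 2) / (k + 1)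

/-- The first pick-freeze estimator, computed from the first `N` observations
`d i = (y_i, (y_i^{u_j})_j)`. -/
def estS {k : ℕ} (N : ℕ) (d : ℕ → ℝ × (Fin k → ℝ)) : EuclideanSpace ℝ (Fin k) :=
  WithLp.toLp 2 fun j =>
    (empMean N (fun i => (d i).1 * (d i).2 j)
        - empMean N (fun i => (d i).1) * empMean N (fun i => (d i).2 j)) /
      (empMean N (fun i => (d i).1 ^ 2) - empMean N (fun i => (d i).1) ^ 2)

/-- The second pick-freeze estimator, computed from the first `N` observations
`d i = (y_i, (y_i^{u_j})_j)`. -/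
def estT {k : ℕ} (N : ℕ) (d : ℕ → ℝ × (Fin k → ℝ)) : EuclideanSpace ℝ (Fin k) :=
  WithLp.toLp 2 fun j =>
    (empMean N (fun i => (d i).1 * (d i).2 j)
        - (empMean N (fun i => (d i).1 + (d i).2 j) / 2) ^ 2) /
      (empMean N (fun i => obsM (d i)) - empMean N (fun i => obsZ (d i)) ^ 2)

/-- The centered version `Z - E(Z)` of a random variable. -/
def centered {Ω : Type*} [MeasurableSpace Ω] (P : Measure Ω) (Z : Ω → ℝ) : Ω → ℝ :=
  fun ω => Z ω - ∫ ω', Z ω' ∂P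

/-- The matrix with entries
`(Cov(Y Y^l, Y Y^j) - s_l Cov(Y Y^j, Q) - s_j Cov(Y Y^l, Q) + s_j s_l Var(Q)) / Var(Y)^2`. -/
def gammaOf {k : ℕ} {Ω : Type*} [MeasurableSpace Ω] (P : Measure Ω) (s : EuclideanSpace ℝ (Fin k))
    (Y : Ω → ℝ) (Yu : Fin k → Ω → ℝ) (Q : Ω → ℝ) : Matrix (Fin k) (Fin k) ℝ :=
  Matrix.of fun l j =>
    (cov[fun ω => Y ω * Yu l ω, fun ω => Y ω * Yu j ω; P]
        - s l * cov[fun ω => Y ω * Yu j ω, Q; P]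
        - s j * cov[fun ω => Y ω * Yu l ω, Q; P]
        + s j * s l * Var[Q; P]) / Var[Y; P] ^ 2

/-- The asymptotic covariance matrix of the first estimator, in terms of the centered outputs;
there `Q` is the square of the centered `Y`. -/
def gammaS {k : ℕ} {Ω : Type*} [MeasurableSpace Ω] (P : Measure Ω) (s : EuclideanSpace ℝ (Fin k))
    (Y : Ω → ℝ) (Yu : Fin k → Ω → ℝ) : Matrix (Fin k) (Fin k) ℝ :=
  gammaOf P s (centered P Y) (fun j => centered P (Yu j)) (fun ω => centered P Y ω ^ 2)

/-- The asymptotic covariance matrix of the second estimator, in terms of the centered outputs;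
there `Q` is `M` formed from the centered outputs. -/
def gammaT {k : ℕ} {Ω : Type*} [MeasurableSpace Ω] (P : Measure Ω) (s : EuclideanSpace ℝ (Fin k))
    (Y : Ω → ℝ) (Yu : Fin k → Ω → ℝ) : Matrix (Fin k) (Fin k) ℝ :=
  gammaOf P s (centered P Y) (fun j => centered P (Yu j))
    (fun ω => obsM (centered P Y ω, fun j => centered P (Yu j) ω))

end PickFreeze

end

/-!
The proof is the delta method, carried out by hand because both estimators are ratios.

The estimators do not change when a constant is subtracted from all the data
(`estS_eq_ratioEst`, `estT_eq_ratioEst`), and `Y`, `Y^{u_1}`, …, `Y^{u_k}` have the same law, so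
they may all be centered by `E(Y)`. Both are then of the form `ratioEst`: the `j`-th component is
`(mean(y y_j) - ρ_j) / (mean(q) - δ)`, where `q` is `y ^ 2` or `M`, and `ρ_j`, `δ` are quadratic in
the empirical means of the centered data.

The pick-freeze identity `covariance_frozenOutput` says
`E(Ȳ Ȳ^{u_j}) = Var(E(Y | X_i, i ∈ u_j)) = s_j Var(Y)`: conditionally on the frozen inputs, `Y` and
`Y^{u_j}` are independent with the same mean. Since moreover `E(q) = Var(Y)`, the vector with
components `Ȳ Ȳ^{u_j} - s_j q`, divided by `Var(Y)`, is centered. It is square-integrable because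
`E(Y^4) < ∞`, and its covariance matrix is `gammaOf` (`covMatrix_influence`), which is therefore
positive semidefinite. Up to the factor `Var(Y) / (mean(q) - δ)`, which tends to `1` by the strong
law of large numbers, `√N (estimator - s)` is the normalized sum of i.i.d. copies of this vector,
minus `√N (ρ_j - s_j δ) / Var(Y)`. The sum converges by the multivariate central limit theorem
`tendstoInDistribution_inv_sqrt_smul_sum`; the last term tends to zero in `L¹`, because squares of
centered means have expectation of order `1 / N`. Slutsky's theorem, in the form
`tendstoInDistribution_of_ratio`, combines these facts in `tendstoInDistribution_ratioEst`.
-/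

noncomputable section

namespace PickFreeze

open Topology

open scoped RealInnerProductSpace

/-! ### The multivariate central limit theorem -/

section CentralLimit

variable {ι Ω Ω' : Type*} [Fintype ι] [MeasurableSpace Ω] [MeasurableSpace Ω']
  {P : Measure Ω} [IsProbabilityMeasure P] {P' : Measure Ω'} [IsProbabilityMeasure P']

/-- The covariance matrix of a random vector. -/
def covMatrix (P : Measure Ω) (W : Ω → EuclideanSpace ℝ ι) : Matrix ι ι ℝ :=
  Matrix.of fun l j => cov[fun ω => W ω l, fun ω => W ω j; P]

lemma variance_inner_eq {W : Ω → EuclideanSpace ℝ ι} (hW : ∀ j, MemLp (fun ω => W ω j) 2 P)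
    (t : ι → ℝ) :
    Var[fun ω => ∑ j, t j * W ω j; P] = t ⬝ᵥ (covMatrix P W).mulVec t := by
  rw [variance_fun_sum fun j => (hW j).const_mul (t j)]
  simp only [covMatrix, dotProduct, Matrix.mulVec, Matrix.of_apply, Finset.mul_sum,
    covariance_const_mul_left, covariance_const_mul_right]
  exact Finset.sum_congr rfl fun i _ => Finset.sum_congr rfl fun j _ => by ring

lemma posSemidef_covMatrix {W : Ω → EuclideanSpace ℝ ι} (hW : ∀ j, MemLp (fun ω => W ω j) 2 P) :
    (covMatrix P W).PosSemidef := by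
  refine Matrix.PosSemidef.of_dotProduct_mulVec_nonneg ?_ fun t => ?_
  · ext l j
    simp [covMatrix, covariance_comm]
  · rw [star_trivial, ← variance_inner_eq hW]
    exact variance_nonneg _ _

/-- **Multivariate central limit theorem** for centered square-integrable i.i.d. vectors. By Lévy's
theorem it reduces to the one-dimensional central limit theorem for the projections
`⟪W n, t⟫` (the Cramér–Wold device). -/
theorem tendstoInDistribution_inv_sqrt_smul_sum [DecidableEq ι] {W : ℕ → Ω' → EuclideanSpace ℝ ι}
    {W₀ : Ω → EuclideanSpace ℝ ι} (hW₀ : ∀ j, MemLp (fun ω => W₀ ω j) 2 P)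
    (hmean : ∀ j, ∫ ω, W₀ ω j ∂P = 0) (hindep : iIndepFun W P')
    (hident : ∀ n, IdentDistrib (W n) W₀ P' P) :
    TendstoInDistribution (fun (N : ℕ) ω => (√(N : ℝ))⁻¹ • ∑ n ∈ Finset.range N, W n ω) atTop id
      (fun _ => P') (multivariateGaussian 0 (covMatrix P W₀)) := by
  have hmeas : ∀ n, AEMeasurable (W n) P' := fun n => (hident n).aemeasurable_fst
  have hS : ∀ N : ℕ, AEMeasurable (fun ω => (√(N : ℝ))⁻¹ • ∑ n ∈ Finset.range N, W n ω) P' :=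
    fun N => (Finset.aemeasurable_fun_sum _ fun n _ => hmeas n).const_smul (√(N : ℝ))⁻¹
  refine ⟨hS, aemeasurable_id, ProbabilityMeasure.tendsto_iff_tendsto_charFun.2 fun t => ?_⟩
  let L : EuclideanSpace ℝ ι → ℝ := fun x => ∑ j, t j * x j
  have hL : Measurable L := by fun_prop
  have hLinner : ∀ x, ⟪x, t⟫ = L x := fun x => by simp [PiLp.inner_apply, L]
  have hid : ∀ n, IdentDistrib (L ∘ W n) (L ∘ W₀) P' P := fun n => (hident n).comp hL
  have hLmem : MemLp (L ∘ W₀) 2 P := memLp_finsetSum _ fun j _ => (hW₀ j).const_mul (t j)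
  have hL0 : ∫ ω, (L ∘ W 0) ω ∂P' = 0 := by
    rw [(hid 0).integral_eq]
    simp only [L, Function.comp_def]
    rw [integral_finsetSum _ fun j _ =>
      ((hW₀ j).const_mul (t j)).integrable one_le_two]
    simp [integral_const_mul, hmean]
  have hVar : Var[L ∘ W 0; P'] = t ⬝ᵥ (covMatrix P W₀).mulVec t := by
    rw [(hid 0).variance_eq, ← variance_inner_eq hW₀]
    rfl
  have hclt := tendstoInDistribution_inv_sqrt_mul_sum_sub
    (P := P') (X := fun n => L ∘ W n) (Y := id)
    (P' := gaussianReal 0 Var[L ∘ W 0; P'].toNNReal) ⟨aemeasurable_id, Measure.map_id⟩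
    ((hid 0).memLp_iff.2 hLmem) (hindep.comp _ fun _ => hL)
    fun n => (hid n).trans (hid 0).symm
  have hchar := ProbabilityMeasure.tendsto_iff_tendsto_charFun.1 hclt.tendsto 1
  simp only [hL0, mul_zero, sub_zero, ProbabilityMeasure.coe_mk, Measure.map_id,
    charFun_gaussianReal] at hchar
  simp only [ProbabilityMeasure.coe_mk, Measure.map_id,
    charFun_multivariateGaussian (posSemidef_covMatrix hW₀)]
  convert hchar using 2 with N
  · rw [charFun_apply, charFun_apply, integral_map (hS N) (by fun_prop), integral_map]
    · refine integral_congr_ae (Eventually.of_forall fun ω => ?_)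
      simp only [hLinner]
      congr 2
      simp only [L, Function.comp_apply, PiLp.smul_apply, smul_eq_mul, WithLp.ofLp_sum,
        Finset.sum_apply, Finset.mul_sum, Real.inner_apply, mul_one]
      rw [Finset.sum_comm]
      exact congrArg _ (Finset.sum_congr rfl fun n _ => Finset.sum_congr rfl fun j _ => by ring)
    · exact (Finset.aemeasurable_fun_sum _ fun n _ => hL.comp_aemeasurable (hmeas n)).const_mul _
    · fun_prop
  · rw [hVar, Real.coe_toNNReal _ (hVar ▸ variance_nonneg _ _)]
    simp

end CentralLimit

/-! ### The pick-freeze identity -/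

section PickFreezeIdentity

variable {α β Ω : Type*} [MeasurableSpace α] [MeasurableSpace β] [MeasurableSpace Ω]
  {P : Measure Ω} [IsProbabilityMeasure P]

/-- Conditioning on `A` a function of `A` and of an independent `B` amounts to integrating
out `B`. -/
lemma condExp_comap_ae_eq_integral_of_indepFun {A : Ω → α} {B : Ω → β} (hA : Measurable A)
    (hB : AEMeasurable B P) (hAB : IndepFun A B P) {g : α × β → ℝ} (hg : Measurable g)
    (hint : Integrable (fun ω => g (A ω, B ω)) P) :
    P[fun ω => g (A ω, B ω) | MeasurableSpace.comap A inferInstance] =ᵐ[P]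
      fun ω => ∫ b, g (A ω, b) ∂(P.map B) := by
  have : IsProbabilityMeasure (P.map A) := Measure.isProbabilityMeasure_map hA.aemeasurable
  have : IsProbabilityMeasure (P.map B) := Measure.isProbabilityMeasure_map hB
  have hprod : P.map (fun ω => (A ω, B ω)) = (P.map A).prod (P.map B) :=
    (indepFun_iff_map_prod_eq_prod_map_map hA.aemeasurable hB).1 hAB
  have hpair : AEMeasurable (fun ω => (A ω, B ω)) P := hA.aemeasurable.prodMk hB
  have hgint : Integrable g ((P.map A).prod (P.map B)) := by
    rw [← hprod]
    exact (integrable_map_measure hg.aestronglyMeasurable hpair).2 hint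
  have hsm : StronglyMeasurable fun a => ∫ b, g (a, b) ∂(P.map B) :=
    hg.stronglyMeasurable.integral_prod_right'
  have hhint : Integrable (fun ω => ∫ b, g (A ω, b) ∂(P.map B)) P :=
    (integrable_map_measure hsm.aestronglyMeasurable hA.aemeasurable).1 hgint.integral_prod_left
  refine (ae_eq_condExp_of_forall_setIntegral_eq hA.comap_le hint
    (fun _ _ _ => hhint.integrableOn) ?_ ?_).symm
  · rintro _ ⟨t, ht, rfl⟩ -
    have h1 : ∫ ω in A ⁻¹' t, (∫ b, g (A ω, b) ∂(P.map B)) ∂P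
        = ∫ a in t, (∫ b, g (a, b) ∂(P.map B)) ∂(P.map A) :=
      (setIntegral_map ht hsm.aestronglyMeasurable hA.aemeasurable).symm
    have h2 : ∫ ω in A ⁻¹' t, g (A ω, B ω) ∂P
        = ∫ z in t ×ˢ Set.univ, g z ∂((P.map A).prod (P.map B)) := by
      rw [← hprod, setIntegral_map (ht.prod MeasurableSet.univ) hg.aestronglyMeasurable hpair]
      congr 2
      ext ω
      simp
    rw [h1, h2, setIntegral_prod _ hgint.integrableOn]
    simp
  · exact (hsm.comp_measurable (comap_measurable A)).aestronglyMeasurable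

/-- Pick-freeze identity for a function of a frozen block `A` and a resampled block `B`:
conditionally on `A`, the two outputs are independent with the same mean. -/
lemma covariance_eq_variance_condExp {A : Ω → α} {B B' : Ω → β} (hA : Measurable A)
    (hB : Measurable B) (hAB : IndepFun A B P) (hABB' : IndepFun (fun ω => (A ω, B ω)) B' P)
    (hid : IdentDistrib B' B P P) {g : α × β → ℝ} (hg : Measurable g)
    (hmem : MemLp (fun ω => g (A ω, B ω)) 2 P) :
    cov[fun ω => g (A ω, B ω), fun ω => g (A ω, B' ω); P] =
      Var[P[fun ω => g (A ω, B ω) | MeasurableSpace.comap A inferInstance]; P] := by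
  have hB' : AEMeasurable B' P := hid.aemeasurable_fst
  have : IsProbabilityMeasure (P.map B) := Measure.isProbabilityMeasure_map hB.aemeasurable
  have hAB' : IndepFun A B' P := hABB'.comp measurable_fst measurable_id
  have hpair : IdentDistrib (fun ω => (A ω, B' ω)) (fun ω => (A ω, B ω)) P P :=
    (IdentDistrib.refl hA.aemeasurable).prodMk hid hAB' hAB
  have hgid : IdentDistrib (fun ω => g (A ω, B' ω)) (fun ω => g (A ω, B ω)) P P := hpair.comp hg
  have hmem' : MemLp (fun ω => g (A ω, B' ω)) 2 P := hgid.memLp_iff.2 hmem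
  let h : α → ℝ := fun a => ∫ b, g (a, b) ∂(P.map B)
  have hcond := condExp_comap_ae_eq_integral_of_indepFun hA hB.aemeasurable hAB hg
    (hmem.integrable one_le_two)
  have hsm : StronglyMeasurable h := hg.stronglyMeasurable.integral_prod_right'
  have hhmem : MemLp (fun ω => h (A ω)) 2 P :=
    (memLp_congr_ae hcond).1 (hmem.condExp one_le_two)
  -- in the mixed moment, integrating out `B'` and then `B` turns both factors into `h (A ω)`
  have hmixed : ∫ ω, g (A ω, B ω) * g (A ω, B' ω) ∂P = ∫ ω, h (A ω) ^ 2 ∂P := by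
    have hG : Measurable fun z : (α × β) × β => g z.1 * g (z.1.1, z.2) := by fun_prop
    have hint : Integrable (fun ω => g (A ω, B ω) * g (A ω, B' ω)) P := hmem.integrable_mul hmem'
    have h1 := condExp_comap_ae_eq_integral_of_indepFun (hA.prodMk hB) hB' hABB' hG hint
    have h2 : ∫ ω, g (A ω, B ω) * g (A ω, B' ω) ∂P = ∫ ω, g (A ω, B ω) * h (A ω) ∂P := by
      rw [← integral_condExp (hA.prodMk hB).comap_le, integral_congr_ae h1]
      simp only [integral_const_mul, hid.map_eq, h]
    have hG3 : Measurable fun z : α × β => g z * h z.1 :=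
      hg.mul (hsm.measurable.comp measurable_fst)
    have h3 := condExp_comap_ae_eq_integral_of_indepFun hA hB.aemeasurable hAB hG3
      (hmem.integrable_mul hhmem)
    rw [h2, ← integral_condExp hA.comap_le, integral_congr_ae h3]
    simp only [integral_mul_const, ← sq, h]
  rw [covariance_eq_sub hmem hmem', variance_congr hcond, variance_eq_sub hhmem,
    hgid.integral_eq, ← integral_congr_ae hcond, integral_condExp hA.comap_le, ← sq]
  congr 1

end PickFreezeIdentity

section Inputs

variable {p : ℕ} {E : Fin p → Type*} {Ω : Type*}

/-- The input whose coordinates in `v` are those of `z.1`, and the others those of `z.2`. -/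
def glue (v : Finset (Fin p)) (z : (∀ i : v, E i) × (∀ i : (vᶜ : Finset (Fin p)), E i)) :
    ∀ i, E i :=
  fun i => if h : i ∈ v then z.1 ⟨i, h⟩ else z.2 ⟨i, Finset.mem_compl.2 h⟩

lemma mix_eq_glue (v : Finset (Fin p)) (x x' : ∀ i, E i) :
    mix v x x' = glue v (fun i => x i, fun i => x' i) := by
  ext i
  by_cases h : i ∈ v <;> simp [mix, glue, h]

lemma output_eq_frozenOutput (f : (∀ i, E i) → ℝ) (v : Finset (Fin p)) (X : ∀ i, Ω → E i) :
    output f X = frozenOutput f v X X := by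
  have hmix : ∀ x : ∀ i, E i, mix v x x = x := fun x => by ext i; simp [mix]
  ext ω
  simp [output, frozenOutput, hmix]

variable [∀ i, MeasurableSpace (E i)] [MeasurableSpace Ω]
  {P : Measure Ω} [IsProbabilityMeasure P] {f : (∀ i, E i) → ℝ} {v : Finset (Fin p)}
  {X X' : ∀ i, Ω → E i}

lemma measurable_glue (v : Finset (Fin p)) : Measurable (glue (E := E) v) := by
  refine measurable_pi_lambda _ fun i => ?_
  by_cases h : i ∈ v
  · simp only [glue, h, dite_true]
    fun_prop
  · simp only [glue, h, dite_false]
    fun_prop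

lemma measurable_restrict_finset (w : Finset (Fin p)) :
    Measurable fun (x : ∀ i, E i) (i : w) => x i := by
  fun_prop

/-- `X` with the block outside `v` resampled has the law of `X`. -/
lemma identDistrib_frozenOutput (hf : Measurable f) (hX : ∀ i, Measurable (X i))
    (hXindep : iIndepFun X P) (hX' : IsIndepCopy P X X') :
    IdentDistrib (frozenOutput f v X X') (output f X) P P := by
  have hB : IdentDistrib (fun ω (i : (vᶜ : Finset (Fin p))) => X' i ω)
      (fun ω (i : (vᶜ : Finset (Fin p))) => X i ω) P P :=
    hX'.2.comp (measurable_restrict_finset vᶜ)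
  have hA : Measurable fun ω (i : v) => X i ω := by fun_prop
  have hpair := (IdentDistrib.refl hA.aemeasurable).prodMk hB
    (hX'.1.comp (measurable_restrict_finset v) (measurable_restrict_finset vᶜ))
    (hXindep.indepFun_finset v vᶜ disjoint_compl_right hX)
  rw [output_eq_frozenOutput f v X]
  unfold frozenOutput
  simp only [mix_eq_glue]
  exact hpair.comp (hf.comp (measurable_glue v))

/-- The **pick-freeze identity**: the covariance of the output and of its pick-freeze version is
the variance explained by the frozen inputs. -/
lemma covariance_frozenOutput (hf : Measurable f) (hX : ∀ i, Measurable (X i))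
    (hXindep : iIndepFun X P) (hX' : IsIndepCopy P X X') (hmem : MemLp (output f X) 2 P) :
    cov[output f X, frozenOutput f v X X'; P] = Var[P[output f X | sigmaOf X v]; P] := by
  have hB : IdentDistrib (fun ω (i : (vᶜ : Finset (Fin p))) => X' i ω)
      (fun ω (i : (vᶜ : Finset (Fin p))) => X i ω) P P :=
    hX'.2.comp (measurable_restrict_finset vᶜ)
  have hindep : IndepFun (fun ω => ((fun (i : v) => X i ω),
      fun (i : (vᶜ : Finset (Fin p))) => X i ω)) (fun ω (i : (vᶜ : Finset (Fin p))) => X' i ω) P :=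
    hX'.1.comp ((measurable_restrict_finset v).prodMk (measurable_restrict_finset vᶜ))
      (measurable_restrict_finset vᶜ)
  rw [output_eq_frozenOutput f v X] at hmem ⊢
  unfold frozenOutput at hmem ⊢
  simp only [mix_eq_glue] at hmem ⊢
  exact covariance_eq_variance_condExp (by fun_prop) (by fun_prop)
    (hXindep.indepFun_finset v vᶜ disjoint_compl_right hX) hindep hB
    (hf.comp (measurable_glue v)) hmem

end Inputs

/-! ### Limit theorems for empirical means -/

section Means

variable {Ω' S : Type*} [MeasurableSpace Ω'] [MeasurableSpace S] {P' : Measure Ω'}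

lemma measurable_empMean {w : S → ℝ} (hw : Measurable w) (N : ℕ) :
    Measurable fun d : ℕ → S => empMean N fun n => w (d n) := by
  unfold empMean
  fun_prop

lemma empMean_add (N : ℕ) (a b : ℕ → ℝ) :
    empMean N (fun n => a n + b n) = empMean N a + empMean N b := by
  simp [empMean, Finset.sum_add_distrib, add_div]

lemma empMean_sub (N : ℕ) (a b : ℕ → ℝ) :
    empMean N (fun n => a n - b n) = empMean N a - empMean N b := by
  simp [empMean, Finset.sum_sub_distrib, sub_div]

lemma empMean_const_mul (N : ℕ) (c : ℝ) (a : ℕ → ℝ) :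
    empMean N (fun n => c * a n) = c * empMean N a := by
  simp [empMean, ← Finset.mul_sum, mul_div_assoc]

lemma empMean_div_const (N : ℕ) (a : ℕ → ℝ) (c : ℝ) :
    empMean N (fun n => a n / c) = empMean N a / c := by
  simp [empMean, ← Finset.sum_div, div_right_comm]

lemma empMean_sum {ι : Type*} [Fintype ι] (N : ℕ) (a : ι → ℕ → ℝ) :
    empMean N (fun n => ∑ j, a j n) = ∑ j, empMean N (a j) := by
  simp [empMean, Finset.sum_comm (s := Finset.range N), Finset.sum_div]

lemma empMean_const {N : ℕ} (hN : N ≠ 0) (c : ℝ) : empMean N (fun _ => c) = c := by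
  have : (N : ℝ) ≠ 0 := Nat.cast_ne_zero.2 hN
  simp [empMean, this]

lemma inv_sqrt_mul_sum_eq (N : ℕ) (a : ℕ → ℝ) :
    (√(N : ℝ))⁻¹ * ∑ n ∈ Finset.range N, a n = √(N : ℝ) * empMean N a := by
  rcases Nat.eq_zero_or_pos N with rfl | hN
  · simp
  · have h : (0 : ℝ) < N := Nat.cast_pos.2 hN
    have h1 : √(N : ℝ) * √(N : ℝ) = N := Real.mul_self_sqrt h.le
    have h2 : √(N : ℝ) ≠ 0 := (Real.sqrt_pos.2 h).ne'
    unfold empMean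
    rw [inv_mul_eq_div, ← mul_div_assoc, div_eq_div_iff h2 h.ne']
    linear_combination -(∑ n ∈ Finset.range N, a n) * h1

/-- Strong law of large numbers for a function of an i.i.d. sample. -/
lemma ae_tendsto_empMean {Ω : Type*} [MeasurableSpace Ω] {P : Measure Ω} {D : ℕ → Ω' → S}
    {U : Ω → S} (hindep : iIndepFun D P') (hident : ∀ n, IdentDistrib (D n) U P' P) {w : S → ℝ}
    (hw : Measurable w) (hint : Integrable (fun ω => w (U ω)) P) :
    ∀ᵐ ω ∂P', Tendsto (fun N => empMean N fun n => w (D n ω)) atTop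
      (𝓝 (∫ ω, w (U ω) ∂P)) := by
  have hid : ∀ n, IdentDistrib (w ∘ D n) (w ∘ U) P' P := fun n => (hident n).comp hw
  have h := strong_law_ae_real (fun n => w ∘ D n) ((hid 0).integrable_iff.2 hint)
    (fun i j hij => (hindep.indepFun hij).comp hw hw) fun n => (hid n).trans (hid 0).symm
  rw [(hid 0).integral_eq] at h
  exact h

/-- The second moment of a centered empirical mean. -/
lemma integral_sq_empMean [IsProbabilityMeasure P'] {Ω : Type*} [MeasurableSpace Ω]
    {P : Measure Ω} [IsProbabilityMeasure P]
    {D : ℕ → Ω' → S} {U : Ω → S} (hindep : iIndepFun D P')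
    (hident : ∀ n, IdentDistrib (D n) U P' P) {w : S → ℝ}
    (hw : Measurable w) (hmem : MemLp (fun ω => w (U ω)) 2 P) (hmean : ∫ ω, w (U ω) ∂P = 0)
    (N : ℕ) :
    Integrable (fun ω => (empMean N fun n => w (D n ω)) ^ 2) P' ∧
      ∫ ω, (empMean N fun n => w (D n ω)) ^ 2 ∂P' = Var[fun ω => w (U ω); P] / N := by
  have hid : ∀ n, IdentDistrib (w ∘ D n) (w ∘ U) P' P := fun n => (hident n).comp hw
  have hm : ∀ n, MemLp (w ∘ D n) 2 P' := fun n => (hid n).memLp_iff.2 hmem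
  have hsum : MemLp (∑ n ∈ Finset.range N, w ∘ D n) 2 P' := memLp_finsetSum' _ fun n _ => hm n
  have hzero : ∫ ω, (∑ n ∈ Finset.range N, w ∘ D n) ω ∂P' = 0 := by
    simp only [Finset.sum_apply]
    rw [integral_finsetSum _ fun n _ => (hm n).integrable one_le_two]
    exact Finset.sum_eq_zero fun n _ => (hid n).integral_eq.trans hmean
  have hvar : ∫ ω, ((∑ n ∈ Finset.range N, w ∘ D n) ω) ^ 2 ∂P'
      = N * Var[fun ω => w (U ω); P] := by
    rw [← variance_of_integral_eq_zero hsum.aemeasurable hzero,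
      IndepFun.variance_sum (fun n _ => hm n)
        fun i _ j _ hij => (hindep.indepFun hij).comp hw hw,
      Finset.sum_congr rfl fun n _ => (hid n).variance_eq]
    simp [Function.comp_def]
  have heq : (fun ω => (empMean N fun n => w (D n ω)) ^ 2)
      = fun ω => ((∑ n ∈ Finset.range N, w ∘ D n) ω) ^ 2 / (N : ℝ) ^ 2 := by
    ext ω
    simp [empMean, div_pow]
  rw [heq]
  refine ⟨hsum.integrable_sq.div_const _, ?_⟩
  rw [integral_div, hvar]
  rcases eq_or_ne (N : ℝ) 0 with h | h
  · simp [h]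
  · field_simp

end Means

/-! ### Ratios of empirical means -/

section Ratio

variable {Ω' : Type*} [MeasurableSpace Ω'] {P' : Measure Ω'} [IsProbabilityMeasure P']

lemma tendstoInMeasure_zero_of_norm_le {F : Type*} [NormedAddCommGroup F] {R : ℕ → Ω' → F}
    {Q : ℕ → Ω' → ℝ} (hQ : ∀ N, Integrable (Q N) P') (hR : ∀ N ω, ‖R N ω‖ ≤ Q N ω)
    (hlim : Tendsto (fun N => ∫ ω, Q N ω ∂P') atTop (𝓝 0)) :
    TendstoInMeasure P' R atTop 0 := by
  rw [tendstoInMeasure_iff_measureReal_norm]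
  intro ε hε
  refine squeeze_zero (fun N => measureReal_nonneg) (fun N => ?_) (by simpa using hlim.div_const ε)
  have hmarkov := mul_meas_ge_le_integral_of_nonneg
    (Eventually.of_forall fun ω => (norm_nonneg _).trans (hR N ω)) (hQ N) ε
  rw [le_div_iff₀ hε, mul_comm]
  refine le_trans (mul_le_mul_of_nonneg_left (measureReal_mono fun ω hω => ?_) hε.le) hmarkov
  simp only [Pi.zero_apply, sub_zero, Set.mem_ofPred_eq] at hω ⊢
  exact hω.trans (hR N ω)

/-- Slutsky's theorem for an estimator whose error is, where the denominator `den N` does not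
vanish, the error `Z N - R N` rescaled by `V / den N`. Almost surely the denominator is eventually
nonzero, so the convention for vanishing denominators is immaterial. -/
lemma tendstoInDistribution_of_ratio {F : Type*} [NormedAddCommGroup F] [NormedSpace ℝ F]
    [SecondCountableTopology F] [MeasurableSpace F] [BorelSpace F] {μ : Measure F}
    [IsProbabilityMeasure μ] {T Z R : ℕ → Ω' → F} {den : ℕ → Ω' → ℝ} {V : ℝ} (hV : V ≠ 0)
    (hZ : TendstoInDistribution Z atTop id (fun _ => P') μ)
    (hR : TendstoInMeasure P' R atTop 0) (hRm : ∀ N, AEMeasurable (R N) P')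
    (hden : ∀ᵐ ω ∂P', Tendsto (fun N => den N ω) atTop (𝓝 V))
    (hdenm : ∀ N, AEMeasurable (den N) P') (hTm : ∀ N, AEMeasurable (T N) P')
    (heq : ∀ N ω, den N ω ≠ 0 → T N ω = (V / den N ω) • (Z N ω - R N ω)) :
    TendstoInDistribution T atTop id (fun _ => P') μ := by
  have hZm := hZ.forall_aemeasurable
  have h1 := hZ.continuous_comp_prodMk_of_tendstoInMeasure_const
    (g := fun x : F × F => x.1 - x.2) (by fun_prop) (c := 0) hR hRm
  have hratio : TendstoInMeasure P' (fun N ω => V / den N ω) atTop fun _ => (1 : ℝ) := by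
    refine tendstoInMeasure_of_tendsto_ae
      (fun N => ((hdenm N).const_div V).aestronglyMeasurable) ?_
    filter_upwards [hden] with ω hω
    simpa [hV, Pi.div_def] using (tendsto_const_nhds (x := V)).div hω hV
  have h2 := h1.continuous_comp_prodMk_of_tendstoInMeasure_const
    (g := fun x : F × ℝ => x.2 • x.1) (by fun_prop) (c := 1) hratio
    fun N => (hdenm N).const_div V
  simp only [id_eq, sub_zero, one_smul] at h2
  refine tendstoInDistribution_of_tendstoInMeasure_sub T id h2 ?_ hTm
  refine tendstoInMeasure_of_tendsto_ae (fun N => ?_) ?_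
  · exact ((hTm N).sub
      (((hdenm N).const_div V).smul ((hZm N).sub (hRm N)))).aestronglyMeasurable
  · filter_upwards [hden] with ω hω
    refine tendsto_const_nhds.congr' ?_
    filter_upwards [hω.eventually_ne hV] with N hN
    simp [heq N ω hN]

end Ratio

/-! ### Asymptotic normality for a centered sample -/

section Core

variable {k : ℕ} {Ω Ω' : Type*} [MeasurableSpace Ω] [MeasurableSpace Ω']
  {P : Measure Ω} [IsProbabilityMeasure P] {P' : Measure Ω'}

/-- The squared norm `x.1 ^ 2 + ∑ j, x.2 j ^ 2` of an observation. -/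
def obsSq (x : ℝ × (Fin k → ℝ)) : ℝ := x.1 ^ 2 + ∑ j, x.2 j ^ 2

/-- The vector of the means of the first `N` observations. -/
def obsMean (N : ℕ) (d : ℕ → ℝ × (Fin k → ℝ)) : ℝ × (Fin k → ℝ) :=
  (empMean N fun n => (d n).1, fun j => empMean N fun n => (d n).2 j)

/-- An estimator of `E(y y_j) / E(q)` from centered data: the ratio of the corresponding empirical
means, with corrections `ρ j` and `δ` that are functions of the vector of means. -/
def ratioEst (q : ℝ × (Fin k → ℝ) → ℝ) (ρ : Fin k → ℝ × (Fin k → ℝ) → ℝ)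
    (δ : ℝ × (Fin k → ℝ) → ℝ) (N : ℕ) (d : ℕ → ℝ × (Fin k → ℝ)) : EuclideanSpace ℝ (Fin k) :=
  WithLp.toLp 2 fun j =>
    (empMean N (fun n => (d n).1 * (d n).2 j) - ρ j (obsMean N d)) /
      (empMean N (fun n => q (d n)) - δ (obsMean N d))

/-- The linearization of the error `ratioEst - s`, for one observation. -/
def influence (V : ℝ) (s : EuclideanSpace ℝ (Fin k)) (q : ℝ × (Fin k → ℝ) → ℝ)
    (x : ℝ × (Fin k → ℝ)) : EuclideanSpace ℝ (Fin k) :=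
  WithLp.toLp 2 fun j => V⁻¹ * (x.1 * x.2 j - s j * q x)

lemma measurable_obsMean (N : ℕ) :
    Measurable fun d : ℕ → ℝ × (Fin k → ℝ) => obsMean N d :=
  (measurable_empMean measurable_fst N).prodMk (measurable_pi_lambda _ fun j =>
    measurable_empMean (w := fun x : ℝ × (Fin k → ℝ) => x.2 j) (by fun_prop) N)

lemma covMatrix_influence {C Q : Ω → ℝ} {e : Fin k → Ω → ℝ} {q : ℝ × (Fin k → ℝ) → ℝ}
    (s : EuclideanSpace ℝ (Fin k)) (hCe : ∀ j, MemLp (fun ω => C ω * e j ω) 2 P)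
    (hQ : MemLp Q 2 P) (hq : ∀ ω, q (C ω, fun j => e j ω) = Q ω) :
    covMatrix P (fun ω => influence Var[C; P] s q (C ω, fun j => e j ω)) = gammaOf P s C e Q := by
  ext l j
  simp only [covMatrix, influence, gammaOf, Matrix.of_apply, hq]
  rw [covariance_const_mul_left, covariance_const_mul_right,
    covariance_fun_sub_fun_sub (hCe l) (hQ.const_mul _) (hCe j) (hQ.const_mul _)]
  simp only [covariance_const_mul_left, covariance_const_mul_right, covariance_comm Q,
    covariance_self hQ.aemeasurable]
  ring

/-- Almost surely the vector of means of a centered sample tends to zero. -/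
lemma ae_tendsto_obsSq_obsMean {D : ℕ → Ω' → ℝ × (Fin k → ℝ)} {U : Ω → ℝ × (Fin k → ℝ)}
    (hindep : iIndepFun D P') (hident : ∀ n, IdentDistrib (D n) U P' P)
    (h1 : MemLp (fun ω => (U ω).1) 2 P) (h2 : ∀ j, MemLp (fun ω => (U ω).2 j) 2 P)
    (hm1 : ∫ ω, (U ω).1 ∂P = 0) (hm2 : ∀ j, ∫ ω, (U ω).2 j ∂P = 0) :
    ∀ᵐ ω ∂P', Tendsto (fun N => obsSq (obsMean N fun n => D n ω)) atTop (𝓝 0) := by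
  have hl1 := ae_tendsto_empMean hindep hident measurable_fst (h1.integrable one_le_two)
  have hl2 := ae_all_iff.2 fun j => ae_tendsto_empMean hindep hident
    ((measurable_pi_apply j).comp measurable_snd) ((h2 j).integrable one_le_two)
  simp only [Function.comp_apply, hm2] at hl2
  rw [hm1] at hl1
  filter_upwards [hl1, hl2] with ω hω1 hω2
  simpa [obsSq, obsMean] using
    (hω1.pow 2).add (tendsto_finsetSum Finset.univ fun j _ => (hω2 j).pow 2)

/-- The squared norm of the vector of means of a centered sample has expectation of order
`1 / N`. -/
lemma integral_obsSq_obsMean [IsProbabilityMeasure P'] {D : ℕ → Ω' → ℝ × (Fin k → ℝ)}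
    {U : Ω → ℝ × (Fin k → ℝ)}
    (hindep : iIndepFun D P') (hident : ∀ n, IdentDistrib (D n) U P' P)
    (h1 : MemLp (fun ω => (U ω).1) 2 P) (h2 : ∀ j, MemLp (fun ω => (U ω).2 j) 2 P)
    (hm1 : ∫ ω, (U ω).1 ∂P = 0) (hm2 : ∀ j, ∫ ω, (U ω).2 j ∂P = 0) (N : ℕ) :
    Integrable (fun ω => obsSq (obsMean N fun n => D n ω)) P' ∧
      ∫ ω, obsSq (obsMean N fun n => D n ω) ∂P' =
        (Var[fun ω => (U ω).1; P] + ∑ j, Var[fun ω => (U ω).2 j; P]) / N := by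
  have hs1 := integral_sq_empMean hindep hident measurable_fst h1 hm1 N
  have hs2 := fun j => integral_sq_empMean hindep hident
    ((measurable_pi_apply j).comp measurable_snd) (h2 j) (hm2 j) N
  simp only [Function.comp_apply] at hs2
  have hint2 := integrable_finsetSum Finset.univ fun j _ => (hs2 j).1
  refine ⟨hs1.1.add hint2, ?_⟩
  simp only [obsSq, obsMean]
  rw [integral_add hs1.1 hint2, integral_finsetSum _ fun j _ => (hs2 j).1, hs1.2, add_div,
    Finset.sum_div]
  exact congrArg _ (Finset.sum_congr rfl fun j _ => (hs2 j).2)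

/-- Asymptotic normality of `ratioEst`: the error is the empirical mean of `influence`, up to
the corrections `ρ j` and `δ`. These are bounded by squares of centered means, hence of order
`1 / N` and negligible after multiplication by `√N`. -/
theorem tendstoInDistribution_ratioEst [IsProbabilityMeasure P'] {C Q : Ω → ℝ} {e : Fin k → Ω → ℝ}
    {s : EuclideanSpace ℝ (Fin k)} {q : ℝ × (Fin k → ℝ) → ℝ}
    {ρ : Fin k → ℝ × (Fin k → ℝ) → ℝ} {δ : ℝ × (Fin k → ℝ) → ℝ}
    (hqm : Measurable q) (hρm : ∀ j, Measurable (ρ j)) (hδm : Measurable δ)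
    (hρ : ∀ j x, |ρ j x| ≤ obsSq x) (hδ : ∀ x, |δ x| ≤ obsSq x)
    (hV : Var[C; P] ≠ 0) (hC : MemLp C 2 P) (he : ∀ j, MemLp (e j) 2 P)
    (hCe : ∀ j, MemLp (fun ω => C ω * e j ω) 2 P) (hQ : MemLp Q 2 P)
    (hq : ∀ ω, q (C ω, fun j => e j ω) = Q ω)
    (hC0 : ∫ ω, C ω ∂P = 0) (he0 : ∀ j, ∫ ω, e j ω ∂P = 0)
    (hQV : ∫ ω, Q ω ∂P = Var[C; P]) (hCeV : ∀ j, ∫ ω, C ω * e j ω ∂P = s j * Var[C; P])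
    {D : ℕ → Ω' → ℝ × (Fin k → ℝ)} (hindep : iIndepFun D P')
    (hident : ∀ n, IdentDistrib (D n) (fun ω => (C ω, fun j => e j ω)) P' P) :
    (gammaOf P s C e Q).PosSemidef ∧
      TendstoInDistribution
        (fun (N : ℕ) ω => √(N : ℝ) • (ratioEst q ρ δ N (fun n => D n ω) - s))
        atTop id (fun _ => P') (multivariateGaussian 0 (gammaOf P s C e Q)) := by
  set V := Var[C; P] with hVdef
  have hcov := covMatrix_influence (q := q) s hCe hQ hq
  have hinfm : Measurable (influence V s q) := by
    unfold influence
    fun_prop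
  have hWmem : ∀ j, MemLp (fun ω => influence V s q (C ω, fun j => e j ω) j) 2 P := fun j => by
    simp only [influence, hq]
    exact ((hCe j).sub (hQ.const_mul _)).const_mul _
  have hW0 : ∀ j, ∫ ω, influence V s q (C ω, fun j => e j ω) j ∂P = 0 := fun j => by
    simp only [influence, hq]
    rw [integral_const_mul, integral_sub ((hCe j).integrable one_le_two)
      ((hQ.const_mul _).integrable one_le_two), integral_const_mul, hQV, hCeV]
    simp
  rw [← hcov]
  refine ⟨posSemidef_covMatrix hWmem, ?_⟩
  have hclt := tendstoInDistribution_inv_sqrt_smul_sum hWmem hW0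
    (hindep.comp (fun _ => influence V s q) fun _ => hinfm) fun n => (hident n).comp hinfm
  have hDm : AEMeasurable (fun ω n => D n ω) P' :=
    aemeasurable_pi_lambda _ fun n => (hident n).aemeasurable_fst
  have hmeanm : ∀ N, AEMeasurable (fun ω => obsMean N fun n => D n ω) P' := fun N =>
    (measurable_obsMean N).comp_aemeasurable hDm
  have hdenm : ∀ N, AEMeasurable (fun ω => empMean N (fun n => q (D n ω)) -
      δ (obsMean N fun n => D n ω)) P' := fun N =>
    ((measurable_empMean hqm N).comp_aemeasurable hDm).sub (hδm.comp_aemeasurable (hmeanm N))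
  have hnumm : ∀ N j, AEMeasurable (fun ω => empMean N (fun n => (D n ω).1 * (D n ω).2 j) -
      ρ j (obsMean N fun n => D n ω)) P' := fun N j =>
    ((measurable_empMean (w := fun x : ℝ × (Fin k → ℝ) => x.1 * x.2 j)
      (by fun_prop) N).comp_aemeasurable hDm).sub ((hρm j).comp_aemeasurable (hmeanm N))
  have htoLp : Measurable (WithLp.toLp 2 : (Fin k → ℝ) → EuclideanSpace ℝ (Fin k)) := by fun_prop
  let R : ℕ → Ω' → EuclideanSpace ℝ (Fin k) := fun N ω =>
    WithLp.toLp 2 fun j => √(N : ℝ) * (V⁻¹ * (ρ j (obsMean N fun n => D n ω) -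
      s j * δ (obsMean N fun n => D n ω)))
  have hRm : ∀ N, AEMeasurable (R N) P' := fun N =>
    htoLp.comp_aemeasurable (aemeasurable_pi_lambda _ fun j =>
      ((((hρm j).comp_aemeasurable (hmeanm N)).sub
        ((hδm.comp_aemeasurable (hmeanm N)).const_mul _)).const_mul _).const_mul _)
  refine tendstoInDistribution_of_ratio hV hclt (R := R) ?_ hRm ?_ hdenm ?_ ?_
  · -- the remainder is of order `√N * N⁻¹` in `L¹`
    have hmom := integral_obsSq_obsMean hindep hident hC he hC0 he0
    let K : ℝ := ∑ j, |V⁻¹| * (1 + |s j|)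
    refine tendstoInMeasure_zero_of_norm_le
      (Q := fun N ω => (√(N : ℝ) * K) * obsSq (obsMean N fun n => D n ω))
      (fun N => (hmom N).1.const_mul _) (fun N ω => ?_) ?_
    · generalize hx : obsMean N (fun n => D n ω) = x
      have hsum : ‖R N ω‖ ≤ ∑ j, ‖R N ω j‖ := by
        conv_lhs => rw [← (EuclideanSpace.basisFun (Fin k) ℝ).sum_repr (R N ω)]
        refine (norm_sum_le _ _).trans (Finset.sum_le_sum fun j _ => ?_)
        simp [norm_smul]
      refine hsum.trans ?_
      simp only [K, Finset.mul_sum, Finset.sum_mul]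
      refine Finset.sum_le_sum fun j _ => ?_
      simp only [R, hx, Real.norm_eq_abs, abs_mul, abs_of_nonneg (Real.sqrt_nonneg _)]
      have habs : |ρ j x - s j * δ x| ≤ (1 + |s j|) * obsSq x := by
        have h2 : |s j * δ x| ≤ |s j| * obsSq x := by
          rw [abs_mul]
          exact mul_le_mul_of_nonneg_left (hδ x) (abs_nonneg _)
        linarith [abs_sub (ρ j x) (s j * δ x), hρ j x]
      calc √(N : ℝ) * (|V⁻¹| * |ρ j x - s j * δ x|)
          ≤ √(N : ℝ) * (|V⁻¹| * ((1 + |s j|) * obsSq x)) := by gcongr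
        _ = √(N : ℝ) * (|V⁻¹| * (1 + |s j|)) * obsSq x := by ring
    · simp only [integral_const_mul, (hmom _).2]
      have hlim : Tendsto (fun N : ℕ => (√(N : ℝ))⁻¹) atTop (𝓝 0) :=
        tendsto_inv_atTop_zero.comp
          (Real.tendsto_sqrt_atTop.comp tendsto_natCast_atTop_atTop)
      have := hlim.const_mul (K * (Var[C; P] + ∑ j, Var[e j; P]))
      rw [mul_zero] at this
      refine this.congr fun N => ?_
      rw [← Real.sqrt_div_self]
      ring
  · have hlln := ae_tendsto_empMean hindep hident hqm
      (by simpa only [hq] using hQ.integrable one_le_two)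
    simp only [hq, hQV] at hlln
    filter_upwards [hlln, ae_tendsto_obsSq_obsMean hindep hident hC he hC0 he0] with ω hω1 hω2
    simpa using hω1.sub (squeeze_zero_norm (fun N => hδ _) hω2)
  · intro N
    exact ((htoLp.comp_aemeasurable (aemeasurable_pi_lambda _ fun j =>
      (hnumm N j).div (hdenm N))).sub_const s).const_smul (√(N : ℝ))
  · intro N ω hden
    ext j
    have hsum : ((√(N : ℝ))⁻¹ • ∑ n ∈ Finset.range N, influence V s q (D n ω)) j
        = √(N : ℝ) * (V⁻¹ * (empMean N (fun n => (D n ω).1 * (D n ω).2 j)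
          - s j * empMean N (fun n => q (D n ω)))) := by
      simp only [PiLp.smul_apply, WithLp.ofLp_sum, Finset.sum_apply, smul_eq_mul, influence]
      rw [inv_sqrt_mul_sum_eq, empMean_const_mul, empMean_sub, empMean_const_mul]
    simp only [PiLp.smul_apply, PiLp.sub_apply, smul_eq_mul, Function.comp_apply] at hsum ⊢
    rw [hsum]
    simp only [ratioEst, R]
    field_simp
    ring

end Core

/-! ### Reduction of the pick-freeze estimators to centered data -/

section Reduction

variable {k : ℕ}

/-- Subtraction of `m` from every coordinate of an observation. -/
def shift (m : ℝ) (x : ℝ × (Fin k → ℝ)) : ℝ × (Fin k → ℝ) := (x.1 - m, fun j => x.2 j - m)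

lemma measurable_shift (m : ℝ) : Measurable (shift (k := k) m) := by
  unfold shift
  fun_prop

lemma measurable_obsM : Measurable (obsM (k := k)) := by
  unfold obsM
  fun_prop

lemma measurable_obsZ : Measurable (obsZ (k := k)) := by
  unfold obsZ
  fun_prop

lemma obsMean_shift {N : ℕ} (hN : N ≠ 0) (m : ℝ) (d : ℕ → ℝ × (Fin k → ℝ)) :
    obsMean N (fun n => shift m (d n)) = shift m (obsMean N d) := by
  simp [obsMean, shift, empMean_sub, empMean_const hN]

lemma empMean_obsZ (N : ℕ) (d : ℕ → ℝ × (Fin k → ℝ)) :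
    empMean N (fun n => obsZ (d n)) = obsZ (obsMean N d) := by
  simp only [obsZ, obsMean, empMean_div_const, empMean_add, empMean_sum]

lemma obsZ_shift (m : ℝ) (x : ℝ × (Fin k → ℝ)) : obsZ (shift m x) = obsZ x - m := by
  have : (k : ℝ) + 1 ≠ 0 := by positivity
  simp only [obsZ, shift, Finset.sum_sub_distrib, Finset.sum_const, Finset.card_univ,
    Fintype.card_fin, nsmul_eq_mul]
  field_simp
  ring

lemma obsM_shift (m : ℝ) (x : ℝ × (Fin k → ℝ)) :
    obsM (shift m x) = obsM x - 2 * m * obsZ x + m ^ 2 := by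
  have : (k : ℝ) + 1 ≠ 0 := by positivity
  simp only [obsM, obsZ, shift, sub_sq, Finset.sum_sub_distrib, Finset.sum_add_distrib,
    Finset.sum_const, Finset.card_univ, Fintype.card_fin, nsmul_eq_mul, ← Finset.mul_sum,
    ← Finset.sum_mul]
  field_simp
  ring

lemma empMean_mul_shift {N : ℕ} (hN : N ≠ 0) (m : ℝ) (a b : ℕ → ℝ) :
    empMean N (fun n => (a n - m) * (b n - m)) =
      empMean N (fun n => a n * b n) - m * empMean N a - m * empMean N b + m ^ 2 := by
  have : (fun n => (a n - m) * (b n - m)) =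
      fun n => a n * b n - m * a n - m * b n + m ^ 2 := by
    ext n
    ring
  rw [this, empMean_add, empMean_sub, empMean_sub, empMean_const_mul, empMean_const_mul,
    empMean_const hN]

/-- The first estimator is shift-invariant. For `N = 0` both sides are the junk value `0 / 0`. -/
lemma estS_eq_ratioEst (m : ℝ) (N : ℕ) (d : ℕ → ℝ × (Fin k → ℝ)) :
    estS N d = ratioEst (fun x => x.1 ^ 2) (fun j x => x.1 * x.2 j) (fun x => x.1 ^ 2) N
      (fun n => shift m (d n)) := by
  rcases eq_or_ne N 0 with rfl | hN
  · ext j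
    simp [estS, ratioEst, empMean, obsMean]
  · ext j
    simp only [estS, ratioEst, obsMean_shift hN]
    simp only [shift, obsMean, sq, empMean_mul_shift hN]
    congr 1 <;> ring

/-- The second estimator is shift-invariant: the numerator because `(Y + Y^u) / 2` is shifted by
`m` too. For `N = 0` both sides are the junk value `0 / 0`. -/
lemma estT_eq_ratioEst (m : ℝ) (N : ℕ) (d : ℕ → ℝ × (Fin k → ℝ)) :
    estT N d = ratioEst obsM (fun j x => ((x.1 + x.2 j) / 2) ^ 2) (fun x => obsZ x ^ 2) N
      (fun n => shift m (d n)) := by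
  rcases eq_or_ne N 0 with rfl | hN
  · ext j
    simp [estT, ratioEst, empMean, obsMean, obsZ]
  · ext j
    simp only [estT, ratioEst, obsMean_shift hN, obsZ_shift, obsM_shift, empMean_add, empMean_sub,
      empMean_const_mul, empMean_const hN, empMean_obsZ]
    simp only [shift, obsMean, empMean_mul_shift hN]
    congr 1 <;> ring

lemma sq_fst_le_obsSq (x : ℝ × (Fin k → ℝ)) : x.1 ^ 2 ≤ obsSq x :=
  le_add_of_nonneg_right (Finset.sum_nonneg fun _ _ => sq_nonneg _)

lemma sq_add_sq_le_obsSq (x : ℝ × (Fin k → ℝ)) (j : Fin k) : x.1 ^ 2 + x.2 j ^ 2 ≤ obsSq x :=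
  add_le_add_right
    (Finset.single_le_sum (f := fun j => x.2 j ^ 2) (fun _ _ => sq_nonneg _) (Finset.mem_univ j)) _

lemma sq_obsZ_le_obsSq (x : ℝ × (Fin k → ℝ)) : obsZ x ^ 2 ≤ obsSq x := by
  -- Cauchy–Schwarz over the `k + 1` coordinates
  have h := sq_sum_le_card_mul_sum_sq (s := (Finset.univ : Finset (Option (Fin k))))
    (f := fun o => o.elim x.1 x.2)
  simp only [Fintype.sum_option, Option.elim, Finset.card_univ, Fintype.card_option,
    Fintype.card_fin, Nat.cast_add, Nat.cast_one] at h
  have hk : (1 : ℝ) ≤ k + 1 := by simp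
  have h0 : 0 ≤ obsSq x := (sq_nonneg _).trans (sq_fst_le_obsSq x)
  rw [obsZ, div_pow, div_le_iff₀ (by positivity)]
  refine h.trans ?_
  change ((k : ℝ) + 1) * obsSq x ≤ _
  nlinarith [mul_nonneg (mul_nonneg h0 (sub_nonneg.2 hk)) (zero_le_one.trans hk)]

end Reduction

section Centered

variable {Ω : Type*} [MeasurableSpace Ω] {P : Measure Ω}

lemma integral_centered_mul (Y Z : Ω → ℝ) :
    ∫ ω, centered P Y ω * centered P Z ω ∂P = cov[Y, Z; P] := rfl

lemma memLp_four_of_integrable_pow {Y : Ω → ℝ} (hY : AEStronglyMeasurable Y P)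
    (hY4 : Integrable (fun ω => Y ω ^ 4) P) : MemLp Y 4 P := by
  rw [← integrable_norm_rpow_iff hY (by simp) (by simp)]
  refine hY4.congr (Eventually.of_forall fun ω => ?_)
  simp only [ENNReal.toReal_ofNat, Real.norm_eq_abs]
  norm_cast
  exact (Even.pow_abs (by decide) _).symm

lemma memLp_two_mul {Y Z : Ω → ℝ} (hY : MemLp Y 4 P) (hZ : MemLp Z 4 P) :
    MemLp (fun ω => Y ω * Z ω) 2 P := by
  have : ENNReal.HolderTriple 4 4 2 := ⟨by
    have h : (2 : ENNReal)⁻¹ + 2⁻¹ = 1 := ENNReal.inv_two_add_inv_two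
    rw [show (4 : ENNReal) = 2 * 2 by norm_num, ENNReal.mul_inv (by simp) (by simp), ← mul_add, h,
      mul_one]⟩
  exact hZ.mul hY

variable [IsProbabilityMeasure P]

lemma integral_centered {Z : Ω → ℝ} (hZ : Integrable Z P) : ∫ ω, centered P Z ω ∂P = 0 := by
  simp only [centered]
  rw [integral_sub hZ (integrable_const _)]
  simp

lemma memLp_centered {Z : Ω → ℝ} {r : ENNReal} (hZ : MemLp Z r P) : MemLp (centered P Z) r P :=
  hZ.sub (memLp_const _)

end Centered

end PickFreeze

end

theorem theorem3p1 {p k : ℕ} {E : Fin p → Type*} [∀ i, MeasurableSpace (E i)]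
    {Ω Ω' : Type*} [MeasurableSpace Ω] [MeasurableSpace Ω']
    (P : Measure Ω) [IsProbabilityMeasure P] (P' : Measure Ω') [IsProbabilityMeasure P']
    (f : (∀ i, E i) → ℝ) (hf : Measurable f)
    (X : ∀ i, Ω → E i) (hX : ∀ i, Measurable (X i)) (hXindep : iIndepFun X P)
    (u : Fin k → Finset (Fin p))
    -- for each `j`, an independent copy of `X`; their joint dependence is arbitrary
    (X' : Fin k → ∀ i, Ω → E i) (hX'meas : ∀ j i, Measurable (X' j i))
    (hX' : ∀ j, PickFreeze.IsIndepCopy P X (X' j))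
    (Y : Ω → ℝ) (hY : Y = PickFreeze.output f X)
    (Yu : Fin k → Ω → ℝ) (hYu : ∀ j, Yu j = PickFreeze.frozenOutput f (u j) X (X' j))
    (hVar : Var[Y; P] ≠ 0) (hY4 : Integrable (fun ω => Y ω ^ 4) P)
    -- an i.i.d. sample of `(Y, Y^{u_1}, …, Y^{u_k})`
    (D : ℕ → Ω' → ℝ × (Fin k → ℝ)) (hDindep : iIndepFun D P')
    (hDident : ∀ n, IdentDistrib (D n) (fun ω => (Y ω, fun j => Yu j ω)) P' P) :
    ((PickFreeze.gammaS P (PickFreeze.closedIndices P X Y u) Y Yu).PosSemidef ∧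
      TendstoInDistribution
        (fun (N : ℕ) ω => √(N : ℝ) •
          (PickFreeze.estS N (fun n => D n ω) - PickFreeze.closedIndices P X Y u))
        atTop id (fun _ => P')
        (multivariateGaussian 0
          (PickFreeze.gammaS P (PickFreeze.closedIndices P X Y u) Y Yu))) ∧
    ((PickFreeze.gammaT P (PickFreeze.closedIndices P X Y u) Y Yu).PosSemidef ∧
      TendstoInDistribution
        (fun (N : ℕ) ω => √(N : ℝ) •
          (PickFreeze.estT N (fun n => D n ω) - PickFreeze.closedIndices P X Y u))
        atTop id (fun _ => P')
        (multivariateGaussian 0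
          (PickFreeze.gammaT P (PickFreeze.closedIndices P X Y u) Y Yu))) := by
  open PickFreeze in
  have hYm : Measurable Y := by
    rw [hY]
    exact hf.comp (measurable_pi_lambda _ hX)
  have hY4' : MemLp Y 4 P := memLp_four_of_integrable_pow hYm.aestronglyMeasurable hY4
  have hY2 : MemLp Y 2 P := hY4'.mono_exponent (by norm_num)
  have hid : ∀ j, IdentDistrib (Yu j) Y P P := fun j => by
    rw [hYu, hY]
    exact identDistrib_frozenOutput hf hX hXindep (hX' j)
  have hYu4 : ∀ j, MemLp (Yu j) 4 P := fun j => (hid j).memLp_iff.2 hY4'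
  have hYu2 : ∀ j, MemLp (Yu j) 2 P := fun j => (hid j).memLp_iff.2 hY2
  have hcov : ∀ j, cov[Y, Yu j; P] = closedIndices P X Y u j * Var[Y; P] := fun j => by
    simp only [closedIndices, closedIndex]
    rw [div_mul_cancel₀ _ hVar, hYu j]
    subst hY
    exact covariance_frozenOutput hf hX hXindep (hX' j) hY2
  -- all coordinates of an observation have the mean of `Y`, so one shift centers them all
  have hshift : ∀ ω, shift (∫ ω', Y ω' ∂P) (Y ω, fun j => Yu j ω) =
      (centered P Y ω, fun j => centered P (Yu j) ω) := fun ω => by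
    simp only [shift, centered, (hid _).integral_eq]
  have hident : ∀ n, IdentDistrib (fun ω => shift (∫ ω', Y ω' ∂P) (D n ω))
      (fun ω => (centered P Y ω, fun j => centered P (Yu j) ω)) P' P := fun n => by
    simp only [← hshift]
    exact (hDident n).comp (measurable_shift _)
  have hindep := hDindep.comp (fun _ => shift (∫ ω', Y ω' ∂P)) fun _ => measurable_shift _
  have hvarC : Var[centered P Y; P] = Var[Y; P] := variance_sub_const hYm.aestronglyMeasurable _
  have hsqmean : ∀ Z : Ω → ℝ, MemLp Z 2 P → ∫ ω, centered P Z ω ^ 2 ∂P = Var[Z; P] := fun Z hZ =>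
    (variance_eq_integral hZ.aemeasurable).symm
  have hsq : ∀ Z : Ω → ℝ, MemLp Z 4 P → MemLp (fun ω => centered P Z ω ^ 2) 2 P := fun Z hZ => by
    simpa only [sq] using memLp_two_mul (memLp_centered hZ) (memLp_centered hZ)
  have hCe : ∀ j, MemLp (fun ω => centered P Y ω * centered P (Yu j) ω) 2 P := fun j =>
    memLp_two_mul (memLp_centered hY4') (memLp_centered (hYu4 j))
  constructor
  · simp only [estS_eq_ratioEst (∫ ω', Y ω' ∂P)]
    refine tendstoInDistribution_ratioEst (by fun_prop) (fun j => by fun_prop) (by fun_prop)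
      (fun j x => ?_) (fun x => ?_) (hvarC ▸ hVar) (memLp_centered hY2)
      (fun j => memLp_centered (hYu2 j)) hCe (hsq Y hY4') (fun ω => rfl)
      (integral_centered (hY2.integrable one_le_two))
      (fun j => integral_centered ((hYu2 j).integrable one_le_two))
      (by rw [hsqmean Y hY2, hvarC]) (fun j => by rw [integral_centered_mul, hcov, hvarC])
      hindep hident
    · refine le_trans ?_ (sq_add_sq_le_obsSq x j)
      rw [abs_le]
      constructor <;> nlinarith [sq_nonneg (x.1 + x.2 j), sq_nonneg (x.1 - x.2 j)]
    · rw [abs_of_nonneg (sq_nonneg _)]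
      exact sq_fst_le_obsSq x
  · simp only [estT_eq_ratioEst (∫ ω', Y ω' ∂P)]
    refine tendstoInDistribution_ratioEst measurable_obsM (fun j => by fun_prop)
      (measurable_obsZ.pow_const 2)
      (fun j x => ?_) (fun x => ?_) (hvarC ▸ hVar) (memLp_centered hY2)
      (fun j => memLp_centered (hYu2 j)) hCe ?_ (fun ω => rfl)
      (integral_centered (hY2.integrable one_le_two))
      (fun j => integral_centered ((hYu2 j).integrable one_le_two))
      ?_ (fun j => by rw [integral_centered_mul, hcov, hvarC])
      hindep hident
    · refine le_trans ?_ (sq_add_sq_le_obsSq x j)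
      rw [abs_of_nonneg (sq_nonneg _)]
      nlinarith [sq_nonneg (x.1 - x.2 j), sq_nonneg x.1, sq_nonneg (x.2 j)]
    · rw [abs_of_nonneg (sq_nonneg _)]
      exact sq_obsZ_le_obsSq x
    · simp only [obsM, div_eq_inv_mul]
      exact ((hsq Y hY4').add (memLp_finsetSum _ fun j _ => hsq _ (hYu4 j))).const_mul _
    · have hk : (k : ℝ) + 1 ≠ 0 := by positivity
      have hi : ∀ j, Integrable (fun ω => centered P (Yu j) ω ^ 2) P := fun j =>
        (hsq _ (hYu4 j)).integrable one_le_two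
      simp only [obsM]
      rw [integral_div, integral_add ((hsq Y hY4').integrable one_le_two)
        (integrable_finsetSum _ fun j _ => hi j), integral_finsetSum _ fun j _ => hi j,
        hsqmean Y hY2, hvarC]
      simp only [hsqmean _ (hYu2 _), (hid _).variance_eq, Finset.sum_const, Finset.card_univ,
        Fintype.card_fin, nsmul_eq_mul]
      field_simp
      ring
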